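/- Let $n\ge 1$. A function $f\in C^\infty((-\infty,0)^n)$ is called absolutely monotone if it and all its partial derivatives of all orders are nonnegative. Let $\mathcal T_n$ be the class of nonpositive functions in $C^\infty((-\infty,0)^n)$ all of whose first order partial derivatives are absolutely monotone. Write $\{\operatorname{Re} z<0\}=\{z\in\mathbb C^n:\operatorname{Re} z_j<0,\ j=1,\dots,n\}$, and let $S_\theta\subset\mathbb C$ be the closure of $\{\zeta:\frac{\pi}{2}+\frac{\theta}{2}<\arg\zeta<\frac{3\pi}{2}-\frac{\theta}{2}\}$. Each function in $\mathcal T_n$ extends uniquely to a function that is holomorphic in $\{\operatorname{Re} z<0\}$ and continuous on the closure of this domain; the extension is denoted by the same letter. Theorem 3. Let $\psi_k\in\mathcal T_n$ $(k\in\mathbb N)$ converge pointwise on $(-\infty,0)^n$ to a function $\psi:(-\infty,0)^n\to\mathbb R$. Then: 1) $\psi\in\mathcal T_n$; 2) $\psi_k\to\psi$ uniformly on compact subsets of $\{\operatorname{Re} z<0\}$; 3) for every $\theta\in(0,\pi)$ and every compact $K\subset S_\theta^n$, the sequence $\psi_k$ is uniformly bounded on $K$, i.e. $\sup_{k}\sup_{z\in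 K}|\psi_k(z)|<\infty$. -/

import Mathlib

open Filter Topology
open scoped ContDiff

namespace NegBernstein

/-- The open negative orthant `(-∞, 0)^n` in `ℝ^n`. -/
def negOrthant (n : ℕ) : Set (Fin n → ℝ) := {s | ∀ j, s j < 0}

/-- The first order partial derivative `∂f/∂s_i`. -/
noncomputable def partialDeriv {n : ℕ} (i : Fin n) (f : (Fin n → ℝ) → ℝ) : (Fin n → ℝ) → ℝ :=
  fun s => fderiv ℝ f s (Pi.single i 1)

/-- `f` is absolutely monotone on `(-∞, 0)^n`: it is of class `C^∞` there and nonnegative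
together with its partial derivatives of all orders. The partial derivative
`∂^m f / ∂s_{i 0} ⋯ ∂s_{i (m-1)}` is the `m`-th Fréchet derivative evaluated at the corresponding
standard basis vectors; `m = 0` gives `f` itself. Values of `f` off the (open) orthant are
irrelevant. -/
def IsAbsolutelyMonotone {n : ℕ} (f : (Fin n → ℝ) → ℝ) : Prop :=
  ContDiffOn ℝ ∞ f (negOrthant n) ∧
    ∀ s ∈ negOrthant n, ∀ (m : ℕ) (i : Fin m → Fin n),
      0 ≤ iteratedFDeriv ℝ m f s (fun l => Pi.single (i l) 1)

/-- The class `T_n` of negative Bernstein functions of `n` variables: nonpositive functions in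
`C^∞((-∞, 0)^n)` all of whose first order partial derivatives are absolutely monotone. -/
def ClassT (n : ℕ) : Set ((Fin n → ℝ) → ℝ) :=
  {ψ | ContDiffOn ℝ ∞ ψ (negOrthant n) ∧ (∀ s ∈ negOrthant n, ψ s ≤ 0) ∧
    ∀ i : Fin n, IsAbsolutelyMonotone (partialDeriv i ψ)}

/-- The domain `{Re z < 0} = {z ∈ ℂ^n : Re z_j < 0, j = 1, …, n}`. -/
def leftDomain (n : ℕ) : Set (Fin n → ℂ) := {z | ∀ j, (z j).re < 0}

/-- `Ψ` is the analytic continuation of `ψ : (-∞, 0)^n → ℝ` to `{Re z < 0}`, extended by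
continuity to the closure of that domain. The values of `Ψ` on the closed domain
are determined by `ψ`; its values elsewhere are irrelevant. -/
structure IsExtension {n : ℕ} (ψ : (Fin n → ℝ) → ℝ) (Ψ : (Fin n → ℂ) → ℂ) : Prop where
  holomorphic : DifferentiableOn ℂ Ψ (leftDomain n)
  continuousOn : ContinuousOn Ψ (closure (leftDomain n))
  agrees : ∀ s ∈ negOrthant n, Ψ (fun j => (s j : ℂ)) = (ψ s : ℂ)

/-- The sector `S_θ`: the closure of `{ζ : π/2 + θ/2 < arg ζ < 3π/2 - θ/2}`. -/
def sector (θ : ℝ) : Set ℂ :=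
  closure {ζ | ∃ r φ : ℝ, 0 < r ∧ Real.pi / 2 + θ / 2 < φ ∧ φ < 3 * Real.pi / 2 - θ / 2 ∧
    ζ = r * Complex.exp (φ * Complex.I)}

/-- The cone `S_θ^n` in `ℂ^n`. -/
def sectorCone (n : ℕ) (θ : ℝ) : Set (Fin n → ℂ) := {z | ∀ j, z j ∈ sector θ}

end NegBernstein

namespace NegBernstein

/-! Everything rests on one positivity estimate. For `ψ` in the class, all derivatives of order at
least one are nonnegative, so Taylor's formula along the diagonal has a nonnegative remainder; with
`ψ ≤ 0` this gives Cauchy estimates for the Taylor coefficients at `a` in terms of `-ψ a` alone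
(`ClassT.sum_taylorCoeff_mul_pow_le`). Hence the Taylor series converges, over `ℝ` and over `ℂ`, in
the sup-norm ball reaching the boundary, and the complex balls centred at `(-N, …, -N)` provide the
continuation.

Nonnegative coefficients also dominate increments: a complex increment of length `d` is at most a
diagonal increment of `ψ` of length `d` (`ClassT.norm_analyticExt_sub_le`). Near the boundary this
gives uniform continuity, hence the continuous extension, and a bound on the oscillation by one
value of `ψ`, hence part 3.

For a convergent sequence the Cauchy estimates are uniform in `k`. Coefficients converge along
ultrafilters, the limit series represents `ψlim`, and so its coefficients are those of `ψlim`. This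
gives part 1 and pointwise convergence of the continuations; domination of increments supplies the
equicontinuity for part 2. -/

/-! ### Higher derivatives of functions in the class -/

lemma isOpen_negOrthant (n : ℕ) : IsOpen (negOrthant n) := by
  simp only [negOrthant, Set.ofPred_forall]
  exact isOpen_iInter_of_finite fun j => isOpen_lt (continuous_apply j) continuous_const

/-- Translates the definition of the class, which concerns derivatives of first partials, into a
sign condition on all derivatives of order at least one. -/
lemma iteratedFDeriv_partialDeriv {n : ℕ} {f : (Fin n → ℝ) → ℝ} {s : Fin n → ℝ}
    (hf : ContDiffAt ℝ ∞ f s) {m : ℕ} (i : Fin (m + 1) → Fin n) :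
    iteratedFDeriv ℝ m (partialDeriv (i (Fin.last m)) f) s
        (fun l => Pi.single (i l.castSucc) 1) =
      iteratedFDeriv ℝ (m + 1) f s (fun l => Pi.single (i l) 1) := by
  have h1 : partialDeriv (i (Fin.last m)) f =
      (ContinuousLinearMap.apply ℝ ℝ (Pi.single (i (Fin.last m)) (1 : ℝ) : Fin n → ℝ)) ∘
        (fderiv ℝ f) := rfl
  have h2 : ContDiffAt ℝ m (fderiv ℝ f) s := hf.fderiv_right (by exact_mod_cast le_top)
  rw [h1, ContinuousLinearMap.iteratedFDeriv_comp_left _ h2 le_rfl, iteratedFDeriv_succ_apply_right]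
  rfl

lemma ClassT.contDiffAt {n : ℕ} {ψ : (Fin n → ℝ) → ℝ} (h : ψ ∈ ClassT n) {s : Fin n → ℝ}
    (hs : s ∈ negOrthant n) : ContDiffAt ℝ ∞ ψ s :=
  h.1.contDiffAt ((isOpen_negOrthant n).mem_nhds hs)

lemma ClassT.iteratedFDeriv_nonneg {n : ℕ} {ψ : (Fin n → ℝ) → ℝ} (h : ψ ∈ ClassT n)
    {s : Fin n → ℝ} (hs : s ∈ negOrthant n) {m : ℕ} (hm : m ≠ 0) (i : Fin m → Fin n) :
    0 ≤ iteratedFDeriv ℝ m ψ s (fun l => Pi.single (i l) 1) := by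
  obtain ⟨m, rfl⟩ := Nat.exists_eq_succ_of_ne_zero hm
  rw [← iteratedFDeriv_partialDeriv (ClassT.contDiffAt h hs)]
  exact (h.2.2 _).2 s hs m _

lemma mem_classT {n : ℕ} {ψ : (Fin n → ℝ) → ℝ} (h1 : ∀ s ∈ negOrthant n, ContDiffAt ℝ ∞ ψ s)
    (h2 : ∀ s ∈ negOrthant n, ψ s ≤ 0)
    (h3 : ∀ s ∈ negOrthant n, ∀ m ≠ 0, ∀ i : Fin m → Fin n,
      0 ≤ iteratedFDeriv ℝ m ψ s (fun l => Pi.single (i l) 1)) : ψ ∈ ClassT n := by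
  refine ⟨fun s hs => (h1 s hs).contDiffWithinAt, h2, fun j => ⟨fun s hs => ?_, ?_⟩⟩
  · have : ContDiffAt ℝ ∞ (fderiv ℝ ψ) s := (h1 s hs).fderiv_right (by simp)
    exact (this.clm_apply contDiffAt_const).contDiffWithinAt
  · intro s hs m i
    have h := h3 s hs (m + 1) (Nat.succ_ne_zero m) (Fin.snoc (α := fun _ => Fin n) i j)
    rw [← iteratedFDeriv_partialDeriv (h1 s hs)] at h
    simpa using h

/-! ### Power series with prescribed real coefficients -/

/-- The formal multilinear series with prescribed real coefficients in the standard basis. -/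
noncomputable def coeffSeries (𝕜 : Type*) [RCLike 𝕜] {n : ℕ} (c : (m : ℕ) → (Fin m → Fin n) → ℝ) :
    FormalMultilinearSeries 𝕜 (Fin n → 𝕜) 𝕜 := fun m =>
  ∑ i : Fin m → Fin n, (c m i : 𝕜) •
    (ContinuousMultilinearMap.mkPiAlgebra 𝕜 (Fin m) 𝕜).compContinuousLinearMap
      (fun l => ContinuousLinearMap.proj (i l))

/-- The Taylor coefficients of `f` at `a`. -/
noncomputable def taylorCoeff {n : ℕ} (f : (Fin n → ℝ) → ℝ) (a : Fin n → ℝ) (m : ℕ)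
    (i : Fin m → Fin n) : ℝ :=
  (m.factorial : ℝ)⁻¹ * iteratedFDeriv ℝ m f a (fun l => Pi.single (i l) 1)

section
variable (𝕜 : Type*) [RCLike 𝕜] {n : ℕ} (c : (m : ℕ) → (Fin m → Fin n) → ℝ)

lemma coeffSeries_apply (m : ℕ) (v : Fin m → Fin n → 𝕜) :
    coeffSeries 𝕜 c m v = ∑ i : Fin m → Fin n, (c m i : 𝕜) * ∏ l, v l (i l) := by
  simp [coeffSeries]

lemma coeffSeries_apply_const (m : ℕ) (t : 𝕜) :
    coeffSeries 𝕜 c m (fun _ _ => t) = (∑ i : Fin m → Fin n, (c m i : 𝕜)) * t ^ m := by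
  simp [coeffSeries_apply, Finset.sum_mul]

/-- Telescoping. The bound is exactly an increment of `t ^ m`, so summing it against nonnegative
coefficients reproduces an increment of the diagonal function. -/
lemma norm_prod_sub_prod_le {m : ℕ} {r d : ℝ} {x y : Fin m → 𝕜} (hx : ∀ l, ‖x l‖ ≤ r)
    (hr : 0 ≤ r) (hd : 0 ≤ d) (hxy : ∀ l, ‖y l - x l‖ ≤ d) :
    ‖∏ l, y l - ∏ l, x l‖ ≤ (r + d) ^ m - r ^ m := by
  induction m with
  | zero => simp
  | succ m ih =>
    have hy : ‖y 0‖ ≤ r + d := by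
      calc ‖y 0‖ = ‖x 0 + (y 0 - x 0)‖ := by ring_nf
        _ ≤ _ := (norm_add_le _ _).trans (add_le_add (hx 0) (hxy 0))
    have hp : ‖∏ l : Fin m, x l.succ‖ ≤ r ^ m := by
      rw [norm_prod]
      simpa using Finset.prod_le_prod (s := Finset.univ) (fun l _ => norm_nonneg (x (Fin.succ l)))
        (fun l _ => hx (Fin.succ l))
    have hi := ih (x := fun l => x l.succ) (y := fun l => y l.succ) (fun l => hx _) (fun l => hxy _)
    rw [Fin.prod_univ_succ, Fin.prod_univ_succ]
    calc ‖y 0 * ∏ l : Fin m, y l.succ - x 0 * ∏ l : Fin m, x l.succ‖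
        = ‖y 0 * (∏ l : Fin m, y l.succ - ∏ l : Fin m, x l.succ) +
            (y 0 - x 0) * ∏ l : Fin m, x l.succ‖ := by ring_nf
      _ ≤ ‖y 0‖ * ‖∏ l : Fin m, y l.succ - ∏ l : Fin m, x l.succ‖ +
            ‖y 0 - x 0‖ * ‖∏ l : Fin m, x l.succ‖ := by
          refine (norm_add_le _ _).trans ?_
          rw [norm_mul, norm_mul]
      _ ≤ (r + d) * ((r + d) ^ m - r ^ m) + d * r ^ m := by
          gcongr
          exact hxy 0
      _ = _ := by ring

lemma norm_coeffSeries_sub_le {m : ℕ} (hc : ∀ i, 0 ≤ c m i) {r d : ℝ} {x y : Fin n → 𝕜}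
    (hx : ‖x‖ ≤ r) (hxy : ‖y - x‖ ≤ d) :
    ‖coeffSeries 𝕜 c m (fun _ => y) - coeffSeries 𝕜 c m (fun _ => x)‖ ≤
      (∑ i, c m i) * ((r + d) ^ m - r ^ m) := by
  have hr := (norm_nonneg _).trans hx
  have hd := (norm_nonneg _).trans hxy
  rw [coeffSeries_apply, coeffSeries_apply, ← Finset.sum_sub_distrib, Finset.sum_mul]
  refine norm_sum_le_of_le _ fun i _ => ?_
  rw [← mul_sub, norm_mul, RCLike.norm_ofReal, abs_of_nonneg (hc i)]
  refine mul_le_mul_of_nonneg_left (norm_prod_sub_prod_le 𝕜 (fun l => (norm_le_pi_norm x _).trans hx)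
    hr hd fun l => ?_) (hc i)
  exact (norm_le_pi_norm (y - x) (i l)).trans hxy

lemma norm_coeffSeries_le (m : ℕ) : ‖coeffSeries 𝕜 c m‖ ≤ ∑ i, |c m i| := by
  refine ContinuousMultilinearMap.opNorm_le_bound (by positivity) fun v => ?_
  rw [coeffSeries_apply, Finset.sum_mul]
  refine norm_sum_le_of_le _ fun i _ => ?_
  rw [norm_mul, RCLike.norm_ofReal, norm_prod]
  gcongr
  exact norm_le_pi_norm _ _

/-- Order zero is left out of the hypothesis because the constant term `ψ a` does not share the sign
of the other coefficients; it does not affect the radius. -/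
lemma le_radius_coeffSeries {r : ℝ} (C : ℝ)
    (h : ∀ t, 0 ≤ t → t < r → ∀ m ≠ 0, (∑ i, |c m i|) * t ^ m ≤ C) :
    ENNReal.ofReal r ≤ (coeffSeries 𝕜 c).radius := by
  refine ENNReal.le_of_forall_nnreal_lt fun t ht => ?_
  have ht' : (t : ℝ) < r := by
    rw [← ENNReal.ofReal_coe_nnreal] at ht
    exact (ENNReal.ofReal_lt_ofReal_iff'.1 ht).1
  refine (coeffSeries 𝕜 c).le_radius_of_bound (max C ‖coeffSeries 𝕜 c 0‖) fun m => ?_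
  rcases eq_or_ne m 0 with rfl | hm
  · simp
  · refine le_trans ?_ ((h t t.2 ht' m hm).trans (le_max_left _ _))
    gcongr
    exact norm_coeffSeries_le 𝕜 c m

end

lemma multilinear_apply_const {n m : ℕ}
    (p : ContinuousMultilinearMap ℝ (fun _ : Fin m => Fin n → ℝ) ℝ) (h : Fin n → ℝ) :
    p (fun _ => h) = ∑ i : Fin m → Fin n, p (fun l => Pi.single (i l) 1) * ∏ l, h (i l) := by
  have hh : h = ∑ j, h j • (Pi.single j (1 : ℝ) : Fin n → ℝ) := by
    ext k
    simp [Finset.sum_apply, Pi.single_apply]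
  conv_lhs => rw [hh]
  have := p.toMultilinearMap.map_sum (fun (_ : Fin m) (j : Fin n) => h j • (Pi.single j (1 : ℝ) : Fin n → ℝ))
  refine this.trans (Finset.sum_congr rfl fun i _ => ?_)
  have h2 := p.toMultilinearMap.map_smul_univ (fun l => h (i l))
    (fun l => (Pi.single (i l) (1 : ℝ) : Fin n → ℝ))
  rw [h2, smul_eq_mul, mul_comm]
  rfl

lemma coeffSeries_taylorCoeff_apply {n : ℕ} (f : (Fin n → ℝ) → ℝ) (a h : Fin n → ℝ) (m : ℕ) :
    coeffSeries ℝ (taylorCoeff f a) m (fun _ => h) =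
      (m.factorial : ℝ)⁻¹ • iteratedFDeriv ℝ m f a (fun _ => h) := by
  rw [coeffSeries_apply, multilinear_apply_const, smul_eq_mul, Finset.mul_sum]
  simp [taylorCoeff, mul_assoc]

/-! ### Cauchy estimates and real analyticity -/

section
variable {n : ℕ} {ψ : (Fin n → ℝ) → ℝ}

lemma ClassT.taylorCoeff_nonneg (h : ψ ∈ ClassT n) {s : Fin n → ℝ} (hs : s ∈ negOrthant n)
    {m : ℕ} (hm : m ≠ 0) (i : Fin m → Fin n) : 0 ≤ taylorCoeff ψ s m i :=
  mul_nonneg (by positivity) (ClassT.iteratedFDeriv_nonneg h hs hm i)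

lemma inv_factorial_mul_iteratedFDeriv_const (f : (Fin n → ℝ) → ℝ) (a : Fin n → ℝ) (m : ℕ) (t : ℝ) :
    (m.factorial : ℝ)⁻¹ * iteratedFDeriv ℝ m f a (fun _ _ => t) =
      (∑ i, taylorCoeff f a m i) * t ^ m := by
  have := coeffSeries_taylorCoeff_apply f a (fun _ => t) m
  rw [coeffSeries_apply_const] at this
  simpa using this.symm

lemma sum_taylorCoeff_zero (f : (Fin n → ℝ) → ℝ) (a : Fin n → ℝ) :
    ∑ i, taylorCoeff f a 0 i = f a := by
  simp [taylorCoeff]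

lemma ClassT.abs_iteratedFDeriv_le (h : ψ ∈ ClassT n) {s : Fin n → ℝ} (hs : s ∈ negOrthant n)
    {m : ℕ} (hm : m ≠ 0) (y : Fin n → ℝ) :
    |iteratedFDeriv ℝ m ψ s (fun _ => y)| ≤
      m.factorial * (∑ i, taylorCoeff ψ s m i) * ‖y‖ ^ m := by
  rw [multilinear_apply_const, Finset.mul_sum, Finset.sum_mul]
  refine (Finset.abs_sum_le_sum_abs _ _).trans (Finset.sum_le_sum fun i _ => ?_)
  have h0 := ClassT.iteratedFDeriv_nonneg h hs hm i
  rw [abs_mul, abs_of_nonneg h0, taylorCoeff, mul_inv_cancel_left₀ (by positivity),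
    Finset.abs_prod]
  gcongr
  simpa using Finset.prod_le_prod (s := Finset.univ) (fun l _ => abs_nonneg (y (i l)))
    (fun l _ => norm_le_pi_norm y (i l))

/-- The integral remainder is nonnegative: in the direction `(t, …, t)` it involves only nonnegative
derivatives of order `N + 1`. -/
lemma ClassT.sum_taylor_le (h : ψ ∈ ClassT n) {a : Fin n → ℝ} {t : ℝ} (ht : 0 ≤ t)
    (hat : ∀ j, a j + t < 0) (N : ℕ) :
    ∑ k ∈ Finset.range (N + 1), (∑ i, taylorCoeff ψ a k i) * t ^ k ≤ ψ (fun j => a j + t) := by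
  have hmem : ∀ u ∈ Set.Icc (0 : ℝ) 1, a + u • (fun _ : Fin n => t) ∈ negOrthant n := by
    intro u hu j
    have : u * t ≤ t := mul_le_of_le_one_left ht hu.2
    have := hat j
    simp only [Pi.add_apply, Pi.smul_apply, smul_eq_mul]
    linarith
  have key := map_add_eq_sum_add_integral_iteratedFDeriv (f := ψ) (x := a)
    (y := fun _ : Fin n => t) (n := N)
    (fun u hu => (ClassT.contDiffAt h (hmem u hu)).of_le (by exact_mod_cast le_top))
  have hfun : (fun j => a j + t) = a + (fun _ : Fin n => t) := rfl
  rw [hfun, key]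
  have hterm : ∀ k, (k.factorial : ℝ)⁻¹ • iteratedFDeriv ℝ k ψ a (fun _ => fun _ : Fin n => t) =
      (∑ i, taylorCoeff ψ a k i) * t ^ k := fun k => inv_factorial_mul_iteratedFDeriv_const ψ a k t
  simp_rw [hterm]
  refine le_add_of_nonneg_right (mul_nonneg (by positivity) ?_)
  refine intervalIntegral.integral_nonneg zero_le_one fun u hu => ?_
  refine mul_nonneg (pow_nonneg (by linarith [hu.2]) _) ?_
  rw [multilinear_apply_const]
  exact Finset.sum_nonneg fun i _ => mul_nonneg
    (ClassT.iteratedFDeriv_nonneg h (hmem u hu) (Nat.succ_ne_zero N) i)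
    (Finset.prod_nonneg fun _ _ => ht)

/-- All terms of positive order are nonnegative and their sum is at most `ψ (a + t) - ψ a ≤ -ψ a`,
so each single term is. -/
lemma ClassT.sum_taylorCoeff_mul_pow_le (h : ψ ∈ ClassT n) {a : Fin n → ℝ} {t : ℝ} (ht : 0 ≤ t)
    (hat : ∀ j, a j + t < 0) {m : ℕ} (hm : m ≠ 0) :
    (∑ i, taylorCoeff ψ a m i) * t ^ m ≤ -ψ a := by
  have ha : a ∈ negOrthant n := fun j => by linarith [hat j]
  have h1 := (ClassT.sum_taylor_le h ht hat m).trans (h.2.1 _ hat)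
  obtain ⟨m, rfl⟩ := Nat.exists_eq_succ_of_ne_zero hm
  rw [Finset.sum_range_succ', sum_taylorCoeff_zero] at h1
  have h2 := Finset.single_le_sum (f := fun k => (∑ i, taylorCoeff ψ a (k + 1) i) * t ^ (k + 1))
    (s := Finset.range (m + 1)) (fun k _ => mul_nonneg (Finset.sum_nonneg fun i _ =>
      ClassT.taylorCoeff_nonneg h ha (Nat.succ_ne_zero k) i) (by positivity))
    (Finset.self_mem_range_succ m)
  simp only [Nat.succ_eq_add_one, pow_zero, mul_one] at *
  linarith

lemma ClassT.le_radius (𝕜 : Type*) [RCLike 𝕜] (h : ψ ∈ ClassT n) {a : Fin n → ℝ} {r : ℝ}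
    (hr : ∀ j, a j + r ≤ 0) : ENNReal.ofReal r ≤ (coeffSeries 𝕜 (taylorCoeff ψ a)).radius := by
  refine le_radius_coeffSeries 𝕜 _ (-ψ a) fun t ht htr m hm => ?_
  have hat : ∀ j, a j + t < 0 := fun j => by linarith [hr j]
  have ha : a ∈ negOrthant n := fun j => by linarith [hat j]
  rw [Finset.sum_congr rfl fun i _ => abs_of_nonneg (ClassT.taylorCoeff_nonneg h ha hm i)]
  exact ClassT.sum_taylorCoeff_mul_pow_le h ht hat hm

/-- On half the ball, every point of the segment from `a` to `a + y` keeps a distance to the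
boundary exceeding some `s > ‖y‖`. The Cauchy estimates at those points then make the remainder
decay like `(N + 1) * (‖y‖ / s) ^ (N + 1)`. -/
lemma ClassT.hasSum_of_norm_lt_half (h : ψ ∈ ClassT n) {a : Fin n → ℝ} {r : ℝ}
    (hr : ∀ j, a j + r ≤ 0) {y : Fin n → ℝ} (hy : ‖y‖ < r / 2) :
    HasSum (fun m => coeffSeries ℝ (taylorCoeff ψ a) m (fun _ => y)) (ψ (a + y)) := by
  obtain ⟨s, hys, hsr⟩ := exists_between hy
  have hs : 0 < s := (norm_nonneg y).trans_lt hys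
  have hbs : ∀ u ∈ Set.Icc (0 : ℝ) 1, ∀ j, (a + u • y) j + s < 0 := by
    intro u hu j
    have h1 : u * y j ≤ ‖y‖ := by
      calc u * y j ≤ |u * y j| := le_abs_self _
        _ = u * ‖y j‖ := by rw [abs_mul, abs_of_nonneg hu.1, Real.norm_eq_abs]
        _ ≤ 1 * ‖y‖ := by
          gcongr
          exacts [hu.2, norm_le_pi_norm y j]
        _ = ‖y‖ := one_mul _
    have := hr j
    simp only [Pi.add_apply, Pi.smul_apply, smul_eq_mul]
    linarith
  have hmem : ∀ u ∈ Set.Icc (0 : ℝ) 1, a + u • y ∈ negOrthant n := fun u hu j => by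
    linarith [hbs u hu j]
  have hcont : ContinuousOn (fun u : ℝ => ψ (a + u • y)) (Set.Icc 0 1) := by
    intro u hu
    have h1 : ContinuousAt (fun u : ℝ => a + u • y) u := by fun_prop
    exact (ContinuousAt.comp (f := fun u : ℝ => a + u • y)
      (ClassT.contDiffAt h (hmem u hu)).continuousAt h1).continuousWithinAt
  obtain ⟨C, hC⟩ := isCompact_Icc.exists_bound_of_continuousOn hcont
  have hsum : HasSum (fun m => coeffSeries ℝ (taylorCoeff ψ a) m (fun _ => y))
      ((coeffSeries ℝ (taylorCoeff ψ a)).sum y) := by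
    refine FormalMultilinearSeries.hasSum _ (Metric.eball_subset_eball (ClassT.le_radius ℝ h hr) ?_)
    rw [Metric.eball_ofReal]
    simp only [Metric.mem_ball, dist_zero_right]
    linarith
  suffices hlim : Tendsto (fun N => ∑ k ∈ Finset.range (N + 1),
      coeffSeries ℝ (taylorCoeff ψ a) k (fun _ => y)) atTop (𝓝 (ψ (a + y))) by
    rwa [tendsto_nhds_unique ((tendsto_add_atTop_iff_nat 1).2 hsum.tendsto_sum_nat) hlim] at hsum
  set q := ‖y‖ / s
  have hq : q < 1 := (div_lt_one hs).2 hys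
  have hq0 : 0 ≤ q := by positivity
  -- The factor `N + 1` is `(N + 1)! / N!`, left over because `(1 - t) ^ N` is merely bounded by
  -- `1`.
  have hrem : Tendsto (fun N : ℕ => C * ((N + 1 : ℕ) * q ^ (N + 1))) atTop (𝓝 0) := by
    have h0 := tendsto_self_mul_const_pow_of_lt_one hq0 hq
    simpa using ((tendsto_add_atTop_iff_nat 1).2 h0).const_mul C
  rw [tendsto_iff_norm_sub_tendsto_zero]
  refine squeeze_zero (fun _ => norm_nonneg _) (fun N => ?_) hrem
  have key := map_add_eq_sum_add_integral_iteratedFDeriv (f := ψ) (x := a) (y := y) (n := N)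
    (fun u hu => (ClassT.contDiffAt h (hmem u hu)).of_le (by exact_mod_cast le_top))
  simp_rw [← coeffSeries_taylorCoeff_apply] at key
  rw [key, ← norm_neg, neg_sub, add_sub_cancel_left, norm_smul]
  have hint : ‖∫ t in (0 : ℝ)..1, (1 - t) ^ N •
      iteratedFDeriv ℝ (N + 1) ψ (a + t • y) (fun _ => y)‖ ≤
      ((N + 1).factorial * (C * q ^ (N + 1))) * |1 - 0| := by
    refine intervalIntegral.norm_integral_le_of_norm_le_const fun t ht => ?_
    rw [Set.uIoc_of_le zero_le_one] at ht
    have ht' : t ∈ Set.Icc (0 : ℝ) 1 := ⟨ht.1.le, ht.2⟩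
    have h1 := ClassT.abs_iteratedFDeriv_le h (hmem t ht') (Nat.succ_ne_zero N) y
    have h2 := ClassT.sum_taylorCoeff_mul_pow_le h hs.le (hbs t ht') (Nat.succ_ne_zero N)
    have h3 : -ψ (a + t • y) ≤ C := (neg_le_abs _).trans (hC t ht')
    have h4 : ‖y‖ = s * q := by simp only [q]; field_simp
    have h5 : ‖(1 - t) ^ N‖ ≤ 1 := by
      rw [norm_pow, Real.norm_eq_abs]
      exact pow_le_one₀ (abs_nonneg _) (abs_le.2 ⟨by linarith [ht'.2], by linarith [ht'.1]⟩)
    rw [norm_smul]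
    calc _ ≤ 1 * (((N + 1).factorial * (∑ i, taylorCoeff ψ (a + t • y) (N + 1) i)
            * ‖y‖ ^ (N + 1))) := mul_le_mul h5 h1 (abs_nonneg _) zero_le_one
      _ = (N + 1).factorial * (((∑ i, taylorCoeff ψ (a + t • y) (N + 1) i) * s ^ (N + 1)) *
            q ^ (N + 1)) := by rw [h4]; ring
      _ ≤ _ := by
        gcongr
        exact h2.trans h3
  calc _ ≤ ‖(N.factorial : ℝ)⁻¹‖ * (((N + 1).factorial * (C * q ^ (N + 1))) * |1 - 0|) := by gcongr
    _ = _ := by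
      have : (N.factorial : ℝ) ≠ 0 := by positivity
      rw [norm_inv, Nat.factorial_succ]
      simp
      field_simp

lemma ball_subset_negOrthant {a : Fin n → ℝ} {r : ℝ} (hr : ∀ j, a j + r ≤ 0) :
    Metric.ball a r ⊆ negOrthant n := by
  intro x hx j
  rw [mem_ball_iff_norm] at hx
  have h1 := (le_abs_self _).trans (norm_le_pi_norm (x - a) j)
  have := hr j
  simp only [Pi.sub_apply] at h1
  linarith

lemma exists_pos_add_le_of_mem_negOrthant {a : Fin n → ℝ} (ha : a ∈ negOrthant n) :
    ∃ r, 0 < r ∧ ∀ j, a j + r ≤ 0 := by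
  obtain ⟨ε, hε, h⟩ := Metric.isOpen_iff.1 (isOpen_negOrthant n) a ha
  refine ⟨ε / 2, by positivity, fun j => ?_⟩
  have : (a + fun _ => ε / 2) ∈ negOrthant n := by
    apply h
    rw [mem_ball_iff_norm, add_sub_cancel_left, pi_norm_lt_iff hε]
    intro i
    rw [Real.norm_eq_abs, abs_of_pos (by positivity)]
    linarith
  exact (this j).le

lemma ClassT.hasFPowerSeriesOnBall_half (h : ψ ∈ ClassT n) {a : Fin n → ℝ} {r : ℝ} (hr0 : 0 < r)
    (hr : ∀ j, a j + r ≤ 0) :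
    HasFPowerSeriesOnBall ψ (coeffSeries ℝ (taylorCoeff ψ a)) a (ENNReal.ofReal (r / 2)) where
  r_le := (ENNReal.ofReal_le_ofReal (by linarith)).trans (ClassT.le_radius ℝ h hr)
  r_pos := ENNReal.ofReal_pos.2 (by positivity)
  hasSum {y} hy := by
    rw [Metric.eball_ofReal, mem_ball_zero_iff] at hy
    exact ClassT.hasSum_of_norm_lt_half h hr hy

lemma ClassT.analyticOnNhd (h : ψ ∈ ClassT n) : AnalyticOnNhd ℝ ψ (negOrthant n) := fun _ ha =>
  let ⟨_, hr0, hr⟩ := exists_pos_add_le_of_mem_negOrthant ha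
  (ClassT.hasFPowerSeriesOnBall_half h hr0 hr).analyticAt

/-- The half-ball result makes `ψ` analytic throughout the orthant; the identity theorem then
carries the equality with the series to the whole ball. -/
lemma ClassT.hasFPowerSeriesOnBall (h : ψ ∈ ClassT n) {a : Fin n → ℝ} {r : ℝ} (hr0 : 0 < r)
    (hr : ∀ j, a j + r ≤ 0) :
    HasFPowerSeriesOnBall ψ (coeffSeries ℝ (taylorCoeff ψ a)) a (ENNReal.ofReal r) := by
  set p := coeffSeries ℝ (taylorCoeff ψ a)
  have hrad : ENNReal.ofReal r ≤ p.radius := ClassT.le_radius ℝ h hr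
  have hpos : 0 < ENNReal.ofReal r := ENNReal.ofReal_pos.2 hr0
  have h1 : HasFPowerSeriesOnBall (fun x => p.sum (x - a)) p a (ENNReal.ofReal r) := by
    simpa using ((p.hasFPowerSeriesOnBall (hpos.trans_le hrad)).mono hpos hrad).comp_sub a
  have h2 := ClassT.hasFPowerSeriesOnBall_half h hr0 hr
  refine h1.congr ?_
  rw [Metric.eball_ofReal]
  have h3 : AnalyticOnNhd ℝ (fun x => p.sum (x - a)) (Metric.ball a r) := by
    rw [← Metric.eball_ofReal]
    exact h1.analyticOnNhd
  refine h3.eqOn_of_preconnected_of_eventuallyEq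
    ((ClassT.analyticOnNhd h).mono (ball_subset_negOrthant hr))
    (convex_ball a r).isPreconnected (Metric.mem_ball_self hr0) ?_
  filter_upwards [Metric.eball_mem_nhds a h2.r_pos] with x hx
  have e1 := h2.hasSum_sub hx
  exact e1.tsum_eq

lemma ClassT.hasSum_diag (h : ψ ∈ ClassT n) {a : Fin n → ℝ} {t : ℝ} (ht : 0 ≤ t)
    (hat : ∀ j, a j + t < 0) :
    HasSum (fun m => (∑ i, taylorCoeff ψ a m i) * t ^ m) (ψ (fun j => a j + t)) := by
  obtain ⟨r, hr0, hr⟩ := exists_pos_add_le_of_mem_negOrthant (a := fun j => a j + t) hat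
  have h1 := ClassT.hasFPowerSeriesOnBall h (a := a) (r := t + r) (by positivity)
    (fun j => by linarith [hr j])
  have h2 := h1.hasSum (y := fun _ => t) (by
    rw [Metric.eball_ofReal, mem_ball_zero_iff, pi_norm_lt_iff (by positivity)]
    intro j
    rw [Real.norm_eq_abs, abs_of_nonneg ht]
    linarith)
  simp_rw [coeffSeries_apply_const] at h2
  simp only [RCLike.ofReal_real_eq_id, id_eq] at h2
  exact h2

/-- The increments of the sum of the Taylor series over `𝕜` are dominated by the increments of
`ψ` along the diagonal direction. -/
lemma ClassT.norm_sum_sub_sum_le (𝕜 : Type*) [RCLike 𝕜] (h : ψ ∈ ClassT n) {a : Fin n → ℝ}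
    {ρ d : ℝ} {x y : Fin n → 𝕜} (hx : ‖x‖ ≤ ρ) (hxy : ‖y - x‖ ≤ d)
    (hat : ∀ j, a j + (ρ + d) < 0) :
    ‖(coeffSeries 𝕜 (taylorCoeff ψ a)).sum y - (coeffSeries 𝕜 (taylorCoeff ψ a)).sum x‖ ≤
      ψ (fun j => a j + (ρ + d)) - ψ (fun j => a j + ρ) := by
  have hρ := (norm_nonneg _).trans hx
  have hd := (norm_nonneg _).trans hxy
  have ha : a ∈ negOrthant n := fun j => by linarith [hat j]
  have hy : ‖y‖ ≤ ρ + d := by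
    calc ‖y‖ = ‖x + (y - x)‖ := by rw [add_sub_cancel]
      _ ≤ _ := (norm_add_le _ _).trans (add_le_add hx hxy)
  obtain ⟨r, hr0, hr⟩ := exists_pos_add_le_of_mem_negOrthant (a := fun j => a j + (ρ + d)) hat
  have hrad := ClassT.le_radius 𝕜 h (a := a) (r := ρ + d + r) (fun j => by linarith [hr j])
  have hs : ∀ z : Fin n → 𝕜, ‖z‖ ≤ ρ + d →
      HasSum (fun m => coeffSeries 𝕜 (taylorCoeff ψ a) m (fun _ => z))
        ((coeffSeries 𝕜 (taylorCoeff ψ a)).sum z) := fun z hz => by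
    refine FormalMultilinearSeries.hasSum _ (Metric.eball_subset_eball hrad ?_)
    rw [Metric.eball_ofReal, mem_ball_zero_iff]
    linarith
  have h1 := (ClassT.hasSum_diag h (by positivity) hat).sub
    (ClassT.hasSum_diag h (a := a) hρ (fun j => by linarith [hat j]))
  refine HasSum.norm_le_of_bounded ((hs y hy).sub (hs x (by linarith))) h1 fun m => ?_
  -- The constant terms cancel, so the sign of `ψ a` is harmless.
  rcases eq_or_ne m 0 with rfl | hm
  · simp [coeffSeries_apply]
  · rw [← mul_sub]
    exact norm_coeffSeries_sub_le 𝕜 _ (ClassT.taylorCoeff_nonneg h ha hm) hx hxy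

end

/-! ### Identity theorem and uniqueness of the extension -/

/-- Two holomorphic functions on a convex open set stable under taking real parts coincide as soon
as they coincide at the real points. -/
lemma eqOn_of_eq_on_real {n : ℕ} {U : Set (Fin n → ℂ)} (hU : IsOpen U) (hconv : Convex ℝ U)
    (hre : ∀ z ∈ U, (fun j => ((z j).re : ℂ)) ∈ U) {f g : (Fin n → ℂ) → ℂ}
    (hf : DifferentiableOn ℂ f U) (hg : DifferentiableOn ℂ g U)
    (hfg : ∀ s : Fin n → ℝ, (fun j => (s j : ℂ)) ∈ U →
      f (fun j => (s j : ℂ)) = g (fun j => (s j : ℂ))) : Set.EqOn f g U := by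
  intro z hz
  -- The complex line `Re z + ζ Im z` has real points for real `ζ` and passes through `z` at `ζ =
  -- I`, which reduces the claim to one variable.
  set L : ℂ → Fin n → ℂ := fun ζ j => ((z j).re : ℂ) + ζ * ((z j).im : ℂ) with hL
  have hLd : Differentiable ℂ L := by
    rw [differentiable_pi]
    intro j
    fun_prop
  set V := L ⁻¹' U
  have hV : IsOpen V := hU.preimage hLd.continuous
  have hVc : Convex ℝ V := by
    intro x hx y hy a b ha hb hab
    have : L (a • x + b • y) = a • L x + b • L y := by
      ext j
      have hab' : (a : ℂ) + b = 1 := by exact_mod_cast hab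
      simp only [hL, Pi.add_apply, Pi.smul_apply, Complex.real_smul]
      linear_combination (-((z j).re : ℂ)) * hab'
    change L _ ∈ U
    rw [this]
    exact hconv hx hy ha hb hab
  have h0 : (0 : ℂ) ∈ V := by
    change L 0 ∈ U
    simpa [hL] using hre z hz
  have hLI : L Complex.I = z := by
    ext j
    simp only [hL]
    rw [mul_comm]
    exact Complex.re_add_im (z j)
  have hI : Complex.I ∈ V := by
    change L Complex.I ∈ U
    rwa [hLI]
  have hmaps : Set.MapsTo L V U := fun _ h => h
  have h1 : AnalyticOnNhd ℂ (f ∘ L) V :=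
    (hf.comp hLd.differentiableOn hmaps).analyticOnNhd hV
  have h2 : AnalyticOnNhd ℂ (g ∘ L) V :=
    (hg.comp hLd.differentiableOn hmaps).analyticOnNhd hV
  have h3 : ∃ᶠ ζ in 𝓝[≠] (0 : ℂ), (f ∘ L) ζ = (g ∘ L) ζ := by
    have ht : Tendsto (fun t : ℝ => (t : ℂ)) (𝓝[≠] 0) (𝓝[≠] 0) := by
      refine tendsto_nhdsWithin_of_tendsto_nhds_of_eventually_within _ ?_ ?_
      · exact (by simpa using Complex.continuous_ofReal.tendsto 0 : Tendsto _ (𝓝 (0 : ℝ)) _).mono_left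
          nhdsWithin_le_nhds
      · filter_upwards [self_mem_nhdsWithin] with t ht
        simpa using ht
    refine ht.frequently (Eventually.frequently ?_)
    have hev := ht.eventually (nhdsWithin_le_nhds (hV.mem_nhds h0))
    filter_upwards [hev] with t htV
    have h4 : L t = fun j => (((z j).re + t * (z j).im : ℝ) : ℂ) := by
      ext j
      simp [hL]
    have h5 : L t ∈ U := htV
    simp only [Function.comp]
    rw [h4] at h5 ⊢
    exact hfg _ h5
  have := h1.eqOn_of_preconnected_of_frequently_eq h2 hVc.isPreconnected h0 h3 hI
  simpa [hLI] using this

lemma isOpen_leftDomain (n : ℕ) : IsOpen (leftDomain n) := by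
  simp only [leftDomain, Set.ofPred_forall]
  exact isOpen_iInter_of_finite fun j =>
    isOpen_lt (Complex.continuous_re.comp (continuous_apply j)) continuous_const

lemma convex_leftDomain (n : ℕ) : Convex ℝ (leftDomain n) := by
  intro x hx y hy a b ha hb hab j
  simp only [Pi.add_apply, Pi.smul_apply, Complex.add_re, Complex.smul_re, smul_eq_mul]
  have := hx j
  have := hy j
  rcases ha.eq_or_lt with rfl | ha
  · nlinarith
  · nlinarith

lemma ofReal_mem_leftDomain {n : ℕ} {s : Fin n → ℝ} :
    (fun j => (s j : ℂ)) ∈ leftDomain n ↔ s ∈ negOrthant n := by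
  simp [leftDomain, negOrthant]

lemma IsExtension.eqOn {n : ℕ} {ψ : (Fin n → ℝ) → ℝ} {Φ Ψ : (Fin n → ℂ) → ℂ}
    (hΦ : IsExtension ψ Φ) (hΨ : IsExtension ψ Ψ) : Set.EqOn Φ Ψ (closure (leftDomain n)) := by
  have h : Set.EqOn Φ Ψ (leftDomain n) := by
    refine eqOn_of_eq_on_real (isOpen_leftDomain n) (convex_leftDomain n) ?_ hΦ.holomorphic
      hΨ.holomorphic fun s hs => ?_
    · intro z hz j
      simpa using hz j
    · rw [hΦ.agrees s (ofReal_mem_leftDomain.1 hs), hΨ.agrees s (ofReal_mem_leftDomain.1 hs)]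
  exact h.of_subset_closure hΦ.continuousOn hΨ.continuousOn subset_closure le_rfl

lemma exists_neg_of_mem_leftDomain {n : ℕ} {z : Fin n → ℂ} (hz : z ∈ leftDomain n) :
    ∃ ρ < 0, ∀ j, (z j).re < ρ := by
  obtain ⟨r, hr0, hr⟩ := exists_pos_add_le_of_mem_negOrthant (a := fun j => (z j).re) hz
  exact ⟨-(r / 2), by linarith, fun j => by linarith [hr j]⟩

/-! ### Analytic continuation -/

/-- The ball of radius `N` about `(-N, …, -N)`. These balls exhaust `leftDomain n`. -/
def tangentBall (n N : ℕ) : Set (Fin n → ℂ) := Metric.ball (fun _ => -(N : ℂ)) N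

lemma re_mem_tangentBall {n N : ℕ} {z : Fin n → ℂ} (hz : z ∈ tangentBall n N) :
    (fun j => ((z j).re : ℂ)) ∈ tangentBall n N := by
  rw [tangentBall, mem_ball_iff_norm] at *
  refine lt_of_le_of_lt ?_ hz
  rw [pi_norm_le_iff_of_nonneg (norm_nonneg _)]
  intro j
  refine le_trans ?_ (norm_le_pi_norm _ j)
  have h : ((z j).re : ℂ) - -(N : ℂ) = ((z j - -(N : ℂ)).re : ℝ) := by simp
  simp only [Pi.sub_apply]
  rw [h, Complex.norm_real]
  exact Complex.abs_re_le_norm _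

/-- The difference of `(N + ρ) ^ 2` and `‖z j + N‖ ^ 2` grows linearly in `N`. Keeping the margin
`ρ` lets the diagonal point at parameter `N + ρ` from the centre be `(ρ, …, ρ)`, whatever `N` is. -/
lemma eventually_norm_sub_le {n : ℕ} {z : Fin n → ℂ} {ρ : ℝ} (hz : ∀ j, (z j).re < ρ) :
    ∀ᶠ N : ℕ in atTop, ‖z - fun _ => -(N : ℂ)‖ ≤ N + ρ := by
  have h1 : ∀ᶠ N : ℕ in atTop, 0 ≤ (N : ℝ) + ρ :=
    (tendsto_natCast_atTop_atTop.atTop_add tendsto_const_nhds).eventually_ge_atTop 0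
  have h2 : ∀ᶠ N : ℕ in atTop, ∀ j, ‖z j‖ ^ 2 ≤ ρ ^ 2 + 2 * (ρ - (z j).re) * N := by
    rw [eventually_all]
    intro j
    have : 0 < 2 * (ρ - (z j).re) := by linarith [hz j]
    exact (tendsto_atTop_add_const_left _ (ρ ^ 2)
      (tendsto_natCast_atTop_atTop.const_mul_atTop this)).eventually_ge_atTop _
  filter_upwards [h1, h2] with N h1 h2
  rw [pi_norm_le_iff_of_nonneg h1]
  intro j
  refine le_of_sq_le_sq ?_ h1
  have h3 := h2 j
  rw [Complex.sq_norm, Complex.normSq_apply] at h3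
  simp only [Pi.sub_apply]
  rw [Complex.sq_norm, Complex.normSq_apply]
  simp
  nlinarith

section
variable {n : ℕ} {ψ : (Fin n → ℝ) → ℝ}

/-- The sum of the Taylor series of `ψ` at `(-N, …, -N)` as a function of complex variables. -/
noncomputable def complexTaylor (ψ : (Fin n → ℝ) → ℝ) (N : ℕ) (z : Fin n → ℂ) : ℂ :=
  (coeffSeries ℂ (taylorCoeff ψ fun _ => -(N : ℝ))).sum (z - fun _ => -(N : ℂ))

/-- The analytic continuation of `ψ` to `leftDomain n`. -/
noncomputable def analyticExt (ψ : (Fin n → ℝ) → ℝ) (z : Fin n → ℂ) : ℂ :=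
  complexTaylor ψ (Classical.epsilon fun N => z ∈ tangentBall n N) z

lemma coeffSeries_ofReal (c : (m : ℕ) → (Fin m → Fin n) → ℝ) (m : ℕ) (v : Fin n → ℝ) :
    coeffSeries ℂ c m (fun _ j => (v j : ℂ)) = (coeffSeries ℝ c m (fun _ => v) : ℂ) := by
  simp [coeffSeries_apply]

lemma ClassT.differentiableOn_complexTaylor (h : ψ ∈ ClassT n) (N : ℕ) :
    DifferentiableOn ℂ (complexTaylor ψ N) (tangentBall n N) := by
  rcases N.eq_zero_or_pos with rfl | hN
  · intro z hz
    simp [tangentBall] at hz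
  have hN' : 0 < ENNReal.ofReal (N : ℝ) := by simpa using hN
  have hrad := ClassT.le_radius ℂ h (a := fun _ => -(N : ℝ)) (r := N) (fun j => by simp)
  have h1 := (((coeffSeries ℂ (taylorCoeff ψ fun _ => -(N : ℝ))).hasFPowerSeriesOnBall
    (hN'.trans_le hrad)).mono hN' hrad).comp_sub (fun _ : Fin n => -(N : ℂ))
  have h2 := h1.analyticOnNhd.differentiableOn
  rw [zero_add, Metric.eball_ofReal] at h2
  exact h2

lemma ClassT.complexTaylor_ofReal (h : ψ ∈ ClassT n) {N : ℕ} {s : Fin n → ℝ}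
    (hs : (fun j => (s j : ℂ)) ∈ tangentBall n N) :
    complexTaylor ψ N (fun j => (s j : ℂ)) = ψ s := by
  rw [tangentBall, mem_ball_iff_norm] at hs
  have hN : (0 : ℝ) < N := (norm_nonneg _).trans_lt hs
  have hc : ((fun j => (s j : ℂ)) - fun _ => -(N : ℂ)) =
      fun j => (((s - fun _ => -(N : ℝ) : Fin n → ℝ) j : ℝ) : ℂ) := by
    ext j
    simp
  have hs' : ‖s - fun _ => -(N : ℝ)‖ < N := by
    rw [pi_norm_lt_iff hN] at hs ⊢
    intro j
    have := hs j
    rwa [hc, Complex.norm_real] at this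
  have h1 := (ClassT.hasFPowerSeriesOnBall h (a := fun _ => -(N : ℝ)) hN (fun j => by simp)).hasSum_sub
    (y := s) (by rwa [Metric.eball_ofReal, mem_ball_iff_norm])
  have h2 := Complex.hasSum_ofReal.2 h1
  simp_rw [← coeffSeries_ofReal] at h2
  rw [complexTaylor, hc]
  exact h2.tsum_eq

lemma ClassT.eqOn_complexTaylor (h : ψ ∈ ClassT n) (M N : ℕ) :
    Set.EqOn (complexTaylor ψ M) (complexTaylor ψ N) (tangentBall n M ∩ tangentBall n N) := by
  refine eqOn_of_eq_on_real (Metric.isOpen_ball.inter Metric.isOpen_ball)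
    ((convex_ball _ _).inter (convex_ball _ _))
    (fun z hz => ⟨re_mem_tangentBall hz.1, re_mem_tangentBall hz.2⟩)
    ((ClassT.differentiableOn_complexTaylor h M).mono Set.inter_subset_left)
    ((ClassT.differentiableOn_complexTaylor h N).mono Set.inter_subset_right) fun s hs => ?_
  rw [ClassT.complexTaylor_ofReal h hs.1, ClassT.complexTaylor_ofReal h hs.2]

lemma ClassT.analyticExt_eq (h : ψ ∈ ClassT n) {N : ℕ} {z : Fin n → ℂ} (hz : z ∈ tangentBall n N) :
    analyticExt ψ z = complexTaylor ψ N z :=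
  ClassT.eqOn_complexTaylor h _ _
    ⟨Classical.epsilon_spec (p := fun N => z ∈ tangentBall n N) ⟨N, hz⟩, hz⟩

lemma exists_mem_tangentBall {z : Fin n → ℂ} (hz : z ∈ leftDomain n) :
    ∃ N, z ∈ tangentBall n N := by
  obtain ⟨ρ, hρ, h⟩ := exists_neg_of_mem_leftDomain hz
  obtain ⟨N, hN⟩ := (eventually_norm_sub_le h).exists
  exact ⟨N, mem_ball_iff_norm.2 (by linarith)⟩

lemma ClassT.differentiableOn_analyticExt (h : ψ ∈ ClassT n) :
    DifferentiableOn ℂ (analyticExt ψ) (leftDomain n) := by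
  intro z hz
  obtain ⟨N, hN⟩ := exists_mem_tangentBall hz
  have hnhds : tangentBall n N ∈ 𝓝 z := Metric.isOpen_ball.mem_nhds hN
  have h1 := (ClassT.differentiableOn_complexTaylor h N).differentiableAt hnhds
  refine (h1.congr_of_eventuallyEq ?_).differentiableWithinAt
  filter_upwards [hnhds] with w hw using ClassT.analyticExt_eq h hw

lemma ClassT.analyticExt_ofReal (h : ψ ∈ ClassT n) {s : Fin n → ℝ} (hs : s ∈ negOrthant n) :
    analyticExt ψ (fun j => (s j : ℂ)) = ψ s := by
  obtain ⟨N, hN⟩ := exists_mem_tangentBall (ofReal_mem_leftDomain.2 hs)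
  rw [ClassT.analyticExt_eq h hN, ClassT.complexTaylor_ofReal h hN]

/-- The increments of the analytic continuation are dominated by those of `ψ` on the diagonal. -/
lemma ClassT.norm_analyticExt_sub_le (h : ψ ∈ ClassT n) {z w : Fin n → ℂ} {ρ d : ℝ}
    (hz : ∀ j, (z j).re < ρ) (hd : ‖w - z‖ ≤ d) (hρd : ρ + d < 0) :
    ‖analyticExt ψ w - analyticExt ψ z‖ ≤ ψ (fun _ => ρ + d) - ψ (fun _ => ρ) := by
  obtain ⟨N, hN⟩ := (eventually_norm_sub_le hz).exists
  have hd0 := (norm_nonneg _).trans hd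
  have hwz : (w - fun _ => -(N : ℂ)) - (z - fun _ => -(N : ℂ)) = w - z := by abel
  have hzN : z ∈ tangentBall n N := mem_ball_iff_norm.2 (by linarith)
  have hwN : w ∈ tangentBall n N := by
    refine mem_ball_iff_norm.2 ?_
    have := norm_add_le ((w - fun _ => -(N : ℂ)) - (z - fun _ => -(N : ℂ))) (z - fun _ => -(N : ℂ))
    rw [sub_add_cancel, hwz] at this
    linarith
  rw [ClassT.analyticExt_eq h hzN, ClassT.analyticExt_eq h hwN]
  have key := ClassT.norm_sum_sub_sum_le ℂ h (a := fun _ => -(N : ℝ)) hN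
    (y := w - fun _ => -(N : ℂ)) (d := d) (by rwa [hwz]) (fun j => by linarith)
  have e1 : -(N : ℝ) + (N + ρ + d) = ρ + d := by ring
  have e2 : -(N : ℝ) + (N + ρ) = ρ := by ring
  rwa [e1, e2] at key

end

/-! ### Uniform continuity and boundary values -/

section
variable {n : ℕ} {ψ : (Fin n → ℝ) → ℝ}

lemma ClassT.diag_mono (h : ψ ∈ ClassT n) {s t : ℝ} (hst : s ≤ t) (ht : t < 0) :
    ψ (fun _ => s) ≤ ψ (fun _ => t) := by
  have := ClassT.norm_analyticExt_sub_le h (z := fun _ => ((s - 1 : ℝ) : ℂ))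
    (w := fun _ => ((s - 1 : ℝ) : ℂ)) (ρ := s) (d := t - s)
    (fun j => by rw [Complex.ofReal_re]; linarith) (by simpa using hst) (by linarith)
  rw [add_sub_cancel] at this
  linarith [(norm_nonneg _).trans this]

/-- Shift both points left by `u = (δ, …, δ)` and go `z → z - u → w - u → w`. Each leg has length at
most `δ` and a starting point with real parts below `σ - δ`, so it costs at most `ψ σ - ψ (σ - δ)`
on the diagonal; `σ ≥ -δ` gives `σ - δ ≥ -2δ`. -/
lemma ClassT.norm_analyticExt_sub_le_of_le (h : ψ ∈ ClassT n) {z w : Fin n → ℂ}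
    (hz : z ∈ leftDomain n) (hw : w ∈ leftDomain n) {δ : ℝ} (hδ : 0 < δ) (hzw : ‖z - w‖ ≤ δ)
    {L : ℝ} (hL : ∀ t < 0, ψ (fun _ => t) ≤ L) :
    ‖analyticExt ψ z - analyticExt ψ w‖ ≤ 3 * (L - ψ (fun _ => -(2 * δ))) := by
  obtain ⟨ρ₁, h₁, hz⟩ := exists_neg_of_mem_leftDomain hz
  obtain ⟨ρ₂, h₂, hw⟩ := exists_neg_of_mem_leftDomain hw
  obtain ⟨σ, hσ, hσδ, h₁, h₂⟩ : ∃ σ < 0, -δ ≤ σ ∧ ρ₁ ≤ σ ∧ ρ₂ ≤ σ :=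
    ⟨max (-δ) (max ρ₁ ρ₂), by simp [*], by simp, by simp, by simp⟩
  set u : Fin n → ℂ := fun _ => (δ : ℂ)
  have hu : ‖u‖ ≤ δ := by
    rw [pi_norm_le_iff_of_nonneg hδ.le]
    intro j
    simp [u, abs_of_pos hδ]
  have hz' : ∀ j, ((z - u) j).re < σ - δ := fun j => by
    simp only [Pi.sub_apply, Complex.sub_re, u, Complex.ofReal_re]
    linarith [hz j]
  have hw' : ∀ j, ((w - u) j).re < σ - δ := fun j => by
    simp only [Pi.sub_apply, Complex.sub_re, u, Complex.ofReal_re]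
    linarith [hw j]
  have e1 := ClassT.norm_analyticExt_sub_le h (w := z) hz' (d := δ) (by simpa using hu)
    (by linarith)
  have e2 := ClassT.norm_analyticExt_sub_le h (w := w) hw' (d := δ) (by simpa using hu)
    (by linarith)
  have e3 := ClassT.norm_analyticExt_sub_le h (w := z - u) hw' (d := δ) (by simpa using hzw)
    (by linarith)
  rw [sub_add_cancel] at e1 e2 e3
  have e4 : analyticExt ψ z - analyticExt ψ w = (analyticExt ψ z - analyticExt ψ (z - u)) +
    (analyticExt ψ (z - u) - analyticExt ψ (w - u)) -
    (analyticExt ψ w - analyticExt ψ (w - u)) := by ring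
  have e5 := (norm_sub_le ((analyticExt ψ z - analyticExt ψ (z - u)) +
    (analyticExt ψ (z - u) - analyticExt ψ (w - u))) (analyticExt ψ w - analyticExt ψ (w - u))).trans
    (add_le_add_left (norm_add_le _ _) _)
  have e6 := hL σ hσ
  have e7 := ClassT.diag_mono h (show -(2 * δ) ≤ σ - δ by linarith) (by linarith)
  rw [e4]
  linarith

lemma ClassT.exists_dist_analyticExt_lt (h : ψ ∈ ClassT n) {ε : ℝ} (hε : 0 < ε) :
    ∃ δ > 0, ∀ z ∈ leftDomain n, ∀ w ∈ leftDomain n, ‖z - w‖ ≤ δ →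
      dist (analyticExt ψ z) (analyticExt ψ w) < ε := by
  set S := (fun t : ℝ => ψ fun _ => t) '' Set.Iio 0
  have hS : BddAbove S := by
    refine ⟨0, ?_⟩
    rintro _ ⟨t, ht, rfl⟩
    exact h.2.1 _ fun _ => ht
  have hne : S.Nonempty := ⟨_, -1, by simp, rfl⟩
  -- The diagonal values are bounded above by `0`, so `L` can be their supremum; `δ = -t / 2` makes
  -- `-2δ = t`.
  obtain ⟨_, ⟨t, ht, rfl⟩, htε⟩ := exists_lt_of_lt_csSup hne (show sSup S - ε / 3 < sSup S by linarith)
  have ht' : t < 0 := ht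
  refine ⟨-t / 2, by linarith, fun z hz w hw hzw => ?_⟩
  have := ClassT.norm_analyticExt_sub_le_of_le h hz hw (by linarith) hzw (L := sSup S)
    (fun s hs => le_csSup hS ⟨s, hs, rfl⟩)
  rw [show -(2 * (-t / 2)) = t by ring] at this
  rw [dist_eq_norm]
  simp only at htε
  linarith

lemma ClassT.isExtension_extendFrom (h : ψ ∈ ClassT n) :
    IsExtension ψ (extendFrom (leftDomain n) (analyticExt ψ)) := by
  have heq : Set.EqOn (extendFrom (leftDomain n) (analyticExt ψ)) (analyticExt ψ)
      (leftDomain n) := fun z hz => extendFrom_eq (subset_closure hz)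
    ((ClassT.differentiableOn_analyticExt h).continuousOn z hz)
  refine ⟨(ClassT.differentiableOn_analyticExt h).congr heq, ?_, fun s hs => ?_⟩
  · refine continuousOn_extendFrom le_rfl fun z hz => ?_
    have := mem_closure_iff_nhdsWithin_neBot.1 hz
    have hc : Cauchy (map (analyticExt ψ) (𝓝[leftDomain n] z)) := by
      refine Metric.cauchy_iff.2 ⟨inferInstance, fun ε hε => ?_⟩
      obtain ⟨δ, hδ, hd⟩ := ClassT.exists_dist_analyticExt_lt h hε
      refine ⟨_, image_mem_map (inter_mem self_mem_nhdsWithin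
        (mem_nhdsWithin_of_mem_nhds (Metric.ball_mem_nhds z (half_pos hδ)))), ?_⟩
      rintro _ ⟨x, hx, rfl⟩ _ ⟨y, hy, rfl⟩
      refine hd x hx.1 y hy.1 ?_
      rw [← dist_eq_norm]
      have h1 := Metric.mem_ball.1 hx.2
      have h2 := Metric.mem_ball'.1 hy.2
      linarith [dist_triangle x z y]
    exact CompleteSpace.complete hc
  · rw [heq (ofReal_mem_leftDomain.2 hs), ClassT.analyticExt_ofReal h hs]

lemma IsExtension.eq_analyticExt (h : ψ ∈ ClassT n) {Ψ : (Fin n → ℂ) → ℂ} (hΨ : IsExtension ψ Ψ)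
    {z : Fin n → ℂ} (hz : z ∈ leftDomain n) : Ψ z = analyticExt ψ z := by
  rw [hΨ.eqOn (ClassT.isExtension_extendFrom h) (subset_closure hz)]
  exact extendFrom_eq (subset_closure hz)
    ((ClassT.differentiableOn_analyticExt h).continuousOn z hz)

lemma ClassT.sum_abs_taylorCoeff_mul_pow_le (h : ψ ∈ ClassT n) {a : Fin n → ℝ} {t : ℝ} (ht : 0 ≤ t)
    (hat : ∀ j, a j + t < 0) (m : ℕ) : (∑ i, |taylorCoeff ψ a m i|) * t ^ m ≤ -ψ a := by
  have ha : a ∈ negOrthant n := fun j => by linarith [hat j]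
  rcases eq_or_ne m 0 with rfl | hm
  · simp [taylorCoeff, abs_of_nonpos (h.2.1 a ha)]
  · rw [Finset.sum_congr rfl fun i _ => abs_of_nonneg (ClassT.taylorCoeff_nonneg h ha hm i)]
    exact ClassT.sum_taylorCoeff_mul_pow_le h ht hat hm

/-- A function determines only the symmetrized coefficients of its power series; this symmetry
passes to limits and makes them identifiable. -/
lemma ClassT.taylorCoeff_comp_perm (h : ψ ∈ ClassT n) {a : Fin n → ℝ} (ha : a ∈ negOrthant n)
    {m : ℕ} (i : Fin m → Fin n) (σ : Equiv.Perm (Fin m)) :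
    taylorCoeff ψ a m (i ∘ σ) = taylorCoeff ψ a m i := by
  have h1 : ContDiffAt ℝ ω ψ a := (ClassT.analyticOnNhd h a ha).contDiffAt
  have := h1.iteratedFDeriv_comp_perm (fun l => (Pi.single (i l) 1 : Fin n → ℝ)) σ
  simp only [taylorCoeff, ← this]
  rfl

end

/-! ### Passage to the limit -/

lemma coeffSeries_apply_single {n : ℕ} (c : (m : ℕ) → (Fin m → Fin n) → ℝ) (m : ℕ)
    (i : Fin m → Fin n) : coeffSeries ℝ c m (fun l => Pi.single (i l) 1) = c m i := by
  rw [coeffSeries_apply, Finset.sum_eq_single i]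
  · simp
  · intro i' _ hi
    obtain ⟨l, hl⟩ := Function.ne_iff.1 hi
    rw [Finset.prod_eq_zero (Finset.mem_univ l) (by simp [hl]), mul_zero]
  · simp

/-- Dominated convergence: the uniform Cauchy estimate at `t > ‖w‖` gives a geometric majorant. -/
lemma tendsto_sum_coeffSeries (𝕜 : Type*) [RCLike 𝕜] {n : ℕ} {ι : Type*} {l : Filter ι}
    {c : ι → (m : ℕ) → (Fin m → Fin n) → ℝ} {c' : (m : ℕ) → (Fin m → Fin n) → ℝ} {C t : ℝ}
    (hc : ∀ m i, Tendsto (fun k => c k m i) l (𝓝 (c' m i)))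
    (hC : ∀ k m, (∑ i, |c k m i|) * t ^ m ≤ C) {w : Fin n → 𝕜} (hw : ‖w‖ < t) :
    Tendsto (fun k => (coeffSeries 𝕜 (c k)).sum w) l (𝓝 ((coeffSeries 𝕜 c').sum w)) := by
  have ht : 0 < t := (norm_nonneg _).trans_lt hw
  have hq : ‖w‖ / t < 1 := (div_lt_one ht).2 hw
  refine tendsto_tsum_of_dominated_convergence (bound := fun m => C * (‖w‖ / t) ^ m)
    ((summable_geometric_of_lt_one (by positivity) hq).mul_left C) (fun m => ?_)
    (Eventually.of_forall fun k m => ?_)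
  · simp only [coeffSeries_apply]
    refine tendsto_finsetSum _ fun i _ => Tendsto.mul_const _ ?_
    exact (RCLike.continuous_ofReal.tendsto _).comp (hc m i)
  · calc ‖coeffSeries 𝕜 (c k) m (fun _ => w)‖
        ≤ ‖coeffSeries 𝕜 (c k) m‖ * ‖w‖ ^ m := by
          simpa using (coeffSeries 𝕜 (c k) m).le_opNorm (fun _ => w)
      _ ≤ (∑ i, |c k m i|) * ‖w‖ ^ m := by
          gcongr
          exact norm_coeffSeries_le 𝕜 _ m
      _ = ((∑ i, |c k m i|) * t ^ m) * (‖w‖ / t) ^ m := by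
          rw [div_pow]
          field_simp
      _ ≤ _ := by
          gcongr
          exact hC k m

section
variable {n : ℕ} {ψ : ℕ → (Fin n → ℝ) → ℝ} {ψlim : (Fin n → ℝ) → ℝ}
  (hψ : ∀ k, ψ k ∈ ClassT n)
  (hlim : ∀ s ∈ negOrthant n, Tendsto (fun k => ψ k s) atTop (𝓝 (ψlim s)))
include hlim

lemma exists_forall_neg_le {s : Fin n → ℝ} (hs : s ∈ negOrthant n) : ∃ C, ∀ k, -ψ k s ≤ C := by
  obtain ⟨B, hB⟩ := (hlim s hs).bddBelow_range
  exact ⟨-B, fun k => neg_le_neg (hB ⟨k, rfl⟩)⟩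

include hψ

/-- The Cauchy estimates confine each coefficient to a compact interval, so all converge along `U`
at once, replacing a diagonal subsequence. The limit series inherits the estimates and sums to the
limit of `ψ k`. -/
lemma hasFPowerSeries_of_ultrafilter {a : Fin n → ℝ} (ha : a ∈ negOrthant n)
    (U : Ultrafilter ℕ) (hU : (U : Filter ℕ) ≤ atTop) :
    ∃ c : (m : ℕ) → (Fin m → Fin n) → ℝ,
      (∀ m i, Tendsto (fun k => taylorCoeff (ψ k) a m i) U (𝓝 (c m i))) ∧
      ∃ r, HasFPowerSeriesOnBall ψlim (coeffSeries ℝ c) a r := by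
  obtain ⟨r, hr0, hr⟩ := exists_pos_add_le_of_mem_negOrthant ha
  obtain ⟨C, hC⟩ := exists_forall_neg_le hlim ha
  have hat : ∀ t < r, ∀ j, a j + t < 0 := fun t ht j => by linarith [hr j]
  have hbd : ∀ t, 0 ≤ t → t < r → ∀ k m, (∑ i, |taylorCoeff (ψ k) a m i|) * t ^ m ≤ C :=
    fun t ht0 htr k m =>
      (ClassT.sum_abs_taylorCoeff_mul_pow_le (hψ k) ht0 (hat t htr) m).trans (hC k)
  have hex : ∀ m (i : Fin m → Fin n), ∃ x, Tendsto (fun k => taylorCoeff (ψ k) a m i) U (𝓝 x) := by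
    intro m i
    have hmem : ∀ k, taylorCoeff (ψ k) a m i ∈ Metric.closedBall 0 (C / (r / 2) ^ m) := fun k => by
      rw [mem_closedBall_zero_iff, le_div_iff₀ (by positivity)]
      refine le_trans ?_ (hbd (r / 2) (by positivity) (by linarith) k m)
      gcongr
      exact Finset.single_le_sum (f := fun i => |taylorCoeff (ψ k) a m i|)
        (fun _ _ => abs_nonneg _) (Finset.mem_univ i)
    obtain ⟨x, _, hx⟩ := (isCompact_closedBall (0 : ℝ) (C / (r / 2) ^ m)).ultrafilter_le_nhds
      (U.map fun k => taylorCoeff (ψ k) a m i)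
      (le_principal_iff.2 (Ultrafilter.mem_map.2 (Filter.univ_mem' hmem)))
    exact ⟨x, hx⟩
  choose c hc using hex
  have hrad : ENNReal.ofReal r ≤ (coeffSeries ℝ c).radius := by
    refine le_radius_coeffSeries ℝ c C fun t ht0 htr m _ => ?_
    exact le_of_tendsto ((tendsto_finsetSum _ fun i _ => (hc m i).abs).mul_const (t ^ m))
      (Eventually.of_forall fun k => hbd t ht0 htr k m)
  refine ⟨c, hc, ENNReal.ofReal r, hrad, ENNReal.ofReal_pos.2 hr0, fun {y} hy => ?_⟩
  have hsum := (coeffSeries ℝ c).hasSum (Metric.eball_subset_eball hrad hy)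
  have hay : a + y ∈ negOrthant n := by
    refine ball_subset_negOrthant hr ?_
    rw [← Metric.eball_ofReal]
    simpa [edist_eq_enorm_sub] using hy
  have hy' : ‖y‖ < r := by rwa [Metric.eball_ofReal, mem_ball_zero_iff] at hy
  obtain ⟨t, hyt, htr⟩ := exists_between hy'
  have ht := tendsto_sum_coeffSeries ℝ hc (hbd t ((norm_nonneg y).trans hyt.le) htr) hyt
  have heq : ∀ k, (coeffSeries ℝ (taylorCoeff (ψ k) a)).sum y = ψ k (a + y) := fun k =>
    ((ClassT.hasFPowerSeriesOnBall (hψ k) hr0 hr).hasSum hy).tsum_eq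
  simp_rw [heq] at ht
  rwa [tendsto_nhds_unique ((hlim _ hay).mono_left hU) ht]

/-- The limit along any ultrafilter is forced by `ψlim`: the `m`-th derivative of a power series
sums its `m`-th term over permutations, which for symmetric `c` is `m ! * c m i`. -/
lemma tendsto_taylorCoeff {a : Fin n → ℝ} (ha : a ∈ negOrthant n) (m : ℕ) (i : Fin m → Fin n) :
    Tendsto (fun k => taylorCoeff (ψ k) a m i) atTop (𝓝 (taylorCoeff ψlim a m i)) := by
  rw [tendsto_iff_ultrafilter]
  intro U hU
  obtain ⟨c, hc, r, hr⟩ := hasFPowerSeries_of_ultrafilter hψ hlim ha U hU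
  have hperm : ∀ σ : Equiv.Perm (Fin m), c m (fun l => i (σ l)) = c m i := fun σ =>
    tendsto_nhds_unique (hc m (i ∘ σ))
      (by simpa only [ClassT.taylorCoeff_comp_perm (hψ _) ha] using hc m i)
  have h1 := hr.iteratedFDeriv_eq_sum_of_completeSpace (n := m)
    (fun l => (Pi.single (i l) 1 : Fin n → ℝ))
  have h2 : ∀ σ : Equiv.Perm (Fin m),
      coeffSeries ℝ c m (fun l => (Pi.single (i (σ l)) 1 : Fin n → ℝ)) = c m i := fun σ =>
    (coeffSeries_apply_single c m fun l => i (σ l)).trans (hperm σ)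
  have h3 : taylorCoeff ψlim a m i = c m i := by
    rw [taylorCoeff, h1, Finset.sum_congr rfl fun σ _ => h2 σ]
    simp [Fintype.card_perm, Nat.factorial_ne_zero]
  rw [h3]
  exact hc m i

lemma mem_classT_of_tendsto : ψlim ∈ ClassT n := by
  refine mem_classT (fun s hs => ?_)
    (fun s hs => le_of_tendsto (hlim s hs) (Eventually.of_forall fun k => (hψ k).2.1 s hs))
    (fun s hs m hm i => ?_)
  · obtain ⟨c, -, r, hr⟩ := hasFPowerSeries_of_ultrafilter hψ hlim hs (Ultrafilter.of atTop)
      (Ultrafilter.of_le atTop)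
    exact hr.analyticAt.contDiffAt
  · have h1 : 0 ≤ taylorCoeff ψlim s m i := ge_of_tendsto (tendsto_taylorCoeff hψ hlim hs m i)
      (Eventually.of_forall fun k => ClassT.taylorCoeff_nonneg (hψ k) hs hm i)
    exact (mul_nonneg_iff_of_pos_left (by positivity)).1 h1

lemma tendsto_analyticExt {z : Fin n → ℂ} (hz : z ∈ leftDomain n) :
    Tendsto (fun k => analyticExt (ψ k) z) atTop (𝓝 (analyticExt ψlim z)) := by
  obtain ⟨N, hN⟩ := exists_mem_tangentBall hz
  simp_rw [fun k => ClassT.analyticExt_eq (hψ k) hN,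
    ClassT.analyticExt_eq (mem_classT_of_tendsto hψ hlim) hN]
  obtain ⟨t, hzt, htN⟩ := exists_between (mem_ball_iff_norm.1 hN)
  have ht0 : 0 ≤ t := (norm_nonneg _).trans hzt.le
  have hat : ∀ j : Fin n, -(N : ℝ) + t < 0 := fun _ => by linarith
  have ha : (fun _ => -(N : ℝ)) ∈ negOrthant n := fun j => by linarith [hat j]
  obtain ⟨C, hC⟩ := exists_forall_neg_le hlim ha
  exact tendsto_sum_coeffSeries ℂ (tendsto_taylorCoeff hψ hlim ha)
    (fun k m => (ClassT.sum_abs_taylorCoeff_mul_pow_le (hψ k) ht0 hat m).trans (hC k)) hzt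

lemma tendstoLocallyUniformlyOn_analyticExt :
    TendstoLocallyUniformlyOn (fun k => analyticExt (ψ k)) (analyticExt ψlim) atTop
      (leftDomain n) := by
  have hT := mem_classT_of_tendsto hψ hlim
  rw [Metric.tendstoLocallyUniformlyOn_iff]
  intro ε hε z hz
  obtain ⟨ρ, hρ, hzρ⟩ := exists_neg_of_mem_leftDomain hz
  have hcont : ContinuousAt (fun t : ℝ => ψlim fun _ => t) ρ :=
    ContinuousAt.comp (f := fun (t : ℝ) (_ : Fin n) => t)
      (ClassT.contDiffAt hT (s := fun _ => ρ) fun _ => hρ).continuousAt (by fun_prop)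
  obtain ⟨η, hη, hηε⟩ := Metric.continuousAt_iff.1 hcont (ε / 3) (by positivity)
  obtain ⟨d, hd0, hdη, hdρ⟩ : ∃ d, 0 < d ∧ d < η ∧ ρ + d < 0 := by
    obtain ⟨d, h1, h2⟩ := exists_between (lt_min hη (neg_pos.2 hρ))
    exact ⟨d, h1, h2.trans_le (min_le_left _ _), by linarith [h2.trans_le (min_le_right _ _)]⟩
  -- Controls the increments of both continuations on the ball: that of `ψlim` directly, that of `ψ
  -- k` for large `k` because the two diagonal values converge.
  have hinc : ψlim (fun _ => ρ + d) - ψlim (fun _ => ρ) < ε / 3 :=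
    (le_abs_self _).trans_lt (hηε (by simpa [abs_of_pos hd0] using hdη))
  refine ⟨Metric.ball z d, mem_nhdsWithin_of_mem_nhds (Metric.ball_mem_nhds z hd0), ?_⟩
  have hk1 := ((hlim (fun _ => ρ + d) fun _ => hdρ).sub (hlim (fun _ => ρ) fun _ => hρ)).eventually
    (gt_mem_nhds hinc)
  have hk2 := (Metric.tendsto_nhds.1 (tendsto_analyticExt hψ hlim hz)) (ε / 3) (by positivity)
  filter_upwards [hk1, hk2] with k hk1 hk2 w hw
  have hw' : ‖w - z‖ ≤ d := (mem_ball_iff_norm.1 hw).le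
  have e1 := ClassT.norm_analyticExt_sub_le (hψ k) hzρ hw' hdρ
  have e2 := ClassT.norm_analyticExt_sub_le hT hzρ hw' hdρ
  rw [← dist_eq_norm] at e1 e2
  rw [dist_comm] at e1 hk2
  have := dist_triangle4 (analyticExt ψlim w) (analyticExt ψlim z) (analyticExt (ψ k) z)
    (analyticExt (ψ k) w)
  linarith

end

/-! ### Uniform bounds up to the boundary -/

lemma sector_subset {θ : ℝ} (hθ : θ ∈ Set.Ioo 0 Real.pi) : sector θ ⊆ closure {ζ | ζ.re < 0} := by
  refine closure_mono ?_
  rintro _ ⟨r, φ, hr, h1, h2, rfl⟩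
  have hcos : Real.cos φ < 0 :=
    Real.cos_neg_of_pi_div_two_lt_of_lt (by linarith [hθ.1]) (by linarith [hθ.1])
  change ((r : ℂ) * Complex.exp (φ * Complex.I)).re < 0
  rw [Complex.re_ofReal_mul, Complex.exp_ofReal_mul_I_re]
  exact mul_neg_of_pos_of_neg hr hcos

lemma sectorCone_subset {n : ℕ} {θ : ℝ} (hθ : θ ∈ Set.Ioo 0 Real.pi) :
    sectorCone n θ ⊆ closure (leftDomain n) := by
  have h : leftDomain n = Set.univ.pi fun _ => {ζ : ℂ | ζ.re < 0} := by
    ext z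
    simp [leftDomain]
  rw [h, closure_pi_set]
  exact fun z hz j _ => sector_subset hθ (hz j)

/-- Every point is compared with `o = (-1, …, -1)`, at distance at most `δ = R + 1`: the value at
`o` contributes `C₁`, and the oscillation bound with `L = 0` contributes `3 * C₂`. -/
lemma exists_forall_norm_le {n : ℕ} {ψ : ℕ → (Fin n → ℝ) → ℝ} {ψlim : (Fin n → ℝ) → ℝ}
    (hψ : ∀ k, ψ k ∈ ClassT n)
    (hlim : ∀ s ∈ negOrthant n, Tendsto (fun k => ψ k s) atTop (𝓝 (ψlim s)))
    {Ψ : ℕ → (Fin n → ℂ) → ℂ} (hΨ : ∀ k, IsExtension (ψ k) (Ψ k)) {K : Set (Fin n → ℂ)}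
    (hK : Bornology.IsBounded K) (hKd : K ⊆ closure (leftDomain n)) :
    ∃ C : ℝ, ∀ k, ∀ z ∈ K, ‖Ψ k z‖ ≤ C := by
  obtain ⟨R, hR0, hR⟩ := hK.exists_pos_norm_lt
  set o : Fin n → ℝ := fun _ => -1
  have ho : o ∈ negOrthant n := fun _ => by simp [o]
  set δ := R + 1
  have hδ : 0 < δ := by positivity
  obtain ⟨C₁, hC₁⟩ := exists_forall_neg_le hlim ho
  obtain ⟨C₂, hC₂⟩ := exists_forall_neg_le hlim (s := fun _ => -(2 * δ)) fun _ => by linarith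
  refine ⟨C₁ + 3 * C₂, fun k z hz => ?_⟩
  -- The bound is proved in the open domain within the ball of radius `R` and reaches boundary
  -- points by continuity.
  have hclosed : IsClosed {z ∈ closure (leftDomain n) | ‖Ψ k z‖ ≤ C₁ + 3 * C₂} :=
    (hΨ k).continuousOn.norm.preimage_isClosed_of_isClosed isClosed_closure isClosed_Iic
  have hsub : leftDomain n ∩ Metric.ball 0 R ⊆
      {z ∈ closure (leftDomain n) | ‖Ψ k z‖ ≤ C₁ + 3 * C₂} := by
    intro w hw
    refine ⟨subset_closure hw.1, ?_⟩
    have hwR := mem_ball_zero_iff.1 hw.2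
    have h1 : ‖w - fun j => (o j : ℂ)‖ ≤ δ := by
      refine (norm_sub_le _ _).trans (add_le_add hwR.le ?_)
      rw [pi_norm_le_iff_of_nonneg zero_le_one]
      simp [o]
    have h2 := ClassT.norm_analyticExt_sub_le_of_le (hψ k) hw.1 (ofReal_mem_leftDomain.2 ho) hδ h1
      (L := 0) (fun t ht => (hψ k).2.1 _ fun _ => ht)
    rw [ClassT.analyticExt_ofReal (hψ k) ho] at h2
    have h3 : ‖(ψ k o : ℂ)‖ = -ψ k o := by
      rw [Complex.norm_real, Real.norm_eq_abs, abs_of_nonpos ((hψ k).2.1 o ho)]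
    have h4 := norm_add_le (analyticExt (ψ k) w - (ψ k o : ℂ)) (ψ k o : ℂ)
    rw [sub_add_cancel] at h4
    rw [(hΨ k).eq_analyticExt (hψ k) hw.1]
    linarith [hC₁ k, hC₂ k]
  refine (closure_minimal hsub hclosed ?_).2
  rw [Set.inter_comm]
  exact Metric.isOpen_ball.inter_closure ⟨mem_ball_zero_iff.2 (hR z hz), hKd hz⟩

end NegBernstein

theorem theorem3 (n : ℕ) (ψ : ℕ → (Fin n → ℝ) → ℝ) (ψlim : (Fin n → ℝ) → ℝ)
    (hψ : ∀ k, ψ k ∈ NegBernstein.ClassT n)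
    (hlim : ∀ s ∈ NegBernstein.negOrthant n, Tendsto (fun k => ψ k s) atTop (𝓝 (ψlim s))) :
    ψlim ∈ NegBernstein.ClassT n ∧
    (∀ k, ∃ Ψ, NegBernstein.IsExtension (ψ k) Ψ) ∧
    (∃ Ψlim, NegBernstein.IsExtension ψlim Ψlim) ∧
    ∀ (Ψ : ℕ → (Fin n → ℂ) → ℂ) (Ψlim : (Fin n → ℂ) → ℂ),
      (∀ k, NegBernstein.IsExtension (ψ k) (Ψ k)) → NegBernstein.IsExtension ψlim Ψlim →
      (∀ K : Set (Fin n → ℂ), IsCompact K → K ⊆ NegBernstein.leftDomain n →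
        TendstoUniformlyOn Ψ Ψlim atTop K) ∧
      (∀ θ ∈ Set.Ioo 0 Real.pi, ∀ K : Set (Fin n → ℂ), IsCompact K →
        K ⊆ NegBernstein.sectorCone n θ →
        ∃ C : ℝ, ∀ k, ∀ z ∈ K, ‖Ψ k z‖ ≤ C) := by
  have hT := NegBernstein.mem_classT_of_tendsto hψ hlim
  refine ⟨hT, fun k => ⟨_, NegBernstein.ClassT.isExtension_extendFrom (hψ k)⟩,
    ⟨_, NegBernstein.ClassT.isExtension_extendFrom hT⟩, fun Ψ Ψlim hΨ hΨlim => ⟨?_, ?_⟩⟩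
  · intro K hK hKd
    have h1 := (tendstoLocallyUniformlyOn_iff_forall_isCompact
      (NegBernstein.isOpen_leftDomain n)).1
      (NegBernstein.tendstoLocallyUniformlyOn_analyticExt hψ hlim) K hKd hK
    refine (h1.congr (Eventually.of_forall fun k z hz => ?_)).congr_right fun z hz => ?_
    · exact ((hΨ k).eq_analyticExt (hψ k) (hKd hz)).symm
    · exact (hΨlim.eq_analyticExt hT (hKd hz)).symm
  · intro θ hθ K hK hKs
    exact NegBernstein.exists_forall_norm_le hψ hlim hΨ hK.isBounded
      (hKs.trans (NegBernstein.sectorCone_subset hθ))
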